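/- Let $p$ be an odd prime, $k\ge 1$, $\zeta_p\in\mathbb{C}$ a primitive $p$-th root of unity and $\mathrm{Tr}$ the absolute trace of $\mathbb{F}_{p^{2k}}$. For $f:\mathbb{F}_{p^{2k}}\to\mathbb{F}_p$ let $\mathcal{W}_f(b)=\sum_{x\in\mathbb{F}_{p^{2k}}}\zeta_p^{f(x)+\mathrm{Tr}(bx)}$. Suppose that $f$ satisfies Condition A with sign $\epsilon$, that is: $f$ is a weakly regular bent function ($|\mathcal{W}_f(b)|=p^k$ for all $b$, and $\mathcal{W}_f(b)=\mu' p^k\zeta_p^{f^*(b)}$ for a constant $\mu'\in\mathbb{C}$ with $|\mu'|=1$ and a function $f^*:\mathbb{F}_{p^{2k}}\to\mathbb{F}_p$); $f(0)=0$ and $f(-x)=f(x)$ for all $x$; there is an integer $l$ with $\gcd(l-1,p-1)=1$ such that $f(\alpha x)=\alpha^l f(x)$ for all $\alpha\in\mathbb{F}_p$ and $x\in\mathbb{F}_{p^{2k}}$; and there are $\epsilon\in\{1,-1\}$ and $f^*:\mathbb{F}_{p^{2k}}\to\mathbb{F}_p$ with $\mathcal{W}_f(b)=\epsilon p^k\zeta_p^{f^*(b)}$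 for all $b\in\mathbb{F}_{p^{2k}}$. Put $$D=\{x\in\mathbb{F}_{p^{2k}}^*: f(x)=0\},\quad D_{\mathcal S}=\{x\in\mathbb{F}_{p^{2k}}^*: f(x)\text{ is a non-zero square}\},\quad D_{\mathcal N}=\{x\in\mathbb{F}_{p^{2k}}^*: f(x)\text{ is a non-square}\}.$$ Then $\{\mathbb{F}_{p^{2k}};\{0\},D,D_{\mathcal S},D_{\mathcal N}\}$ is an amorphic association scheme of class $3$. That is, the relations $R_i=\{(x,y): x-y\in B_i\}$ on $V=\mathbb{F}_{p^{2k}}$ with $(B_0,B_1,B_2,B_3)=(\{0\},D,D_{\mathcal S},D_{\mathcal N})$ form an association scheme: $R_0$ is the diagonal, the $R_i$ partition $V\times V$ (an empty relation being allowed), the transpose of each $R_i$ is some $R_{i'}$, and for all $i,j,m$ the number $|\{z\in V:(x,z)\in R_i,\ (z,y)\in R_j\}|$ is the same for all $(x,y)\in R_m$; and each fusion, obtained by uniting the relations within each block of a partition of $\{1,2,3\}$ and keeping $R_0$, is an association scheme as well. Moreover $D_{\mathcal S}$ and $D_{\mathcal N}$ are non-empty, and $D$ is non-empty except exactly when $k=1$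 and $\epsilon=-1$. -/

import Mathlib

noncomputable section

/-- The Walsh transform of `f : F → 𝔽_p` with respect to `ζ`, a primitive `p`-th root of unity:
`W_f(b) = ∑ x, ζ ^ (f x + Tr (b x))`, where `Tr` is the absolute trace. -/
def walsh {p : ℕ} {F : Type*} [Field F] [Fintype F] [Algebra (ZMod p) F]
    (ζ : ℂ) (f : F → ZMod p) (b : F) : ℂ :=
  ∑ x : F, ζ ^ (f x + Algebra.trace (ZMod p) F (b * x)).val

/-- `f` is `p`-ary bent: all Walsh coefficients have magnitude `p ^ (n / 2) = √|F|`. -/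
def IsBent {p : ℕ} {F : Type*} [Field F] [Fintype F] [Algebra (ZMod p) F]
    (ζ : ℂ) (f : F → ZMod p) : Prop :=
  ∀ b : F, ‖walsh ζ f b‖ = √(Fintype.card F : ℝ)

/-- A weakly regular bent function: `W_f(b) = μ p ^ (n / 2) ζ ^ (f* b)` for all `b`, with a
constant `μ` of modulus one and a function `f* : F → 𝔽_p`. -/
def IsWeaklyRegularBent {p : ℕ} {F : Type*} [Field F] [Fintype F] [Algebra (ZMod p) F]
    (ζ : ℂ) (f : F → ZMod p) : Prop :=
  IsBent ζ f ∧ ∃ μ : ℂ, ‖μ‖ = 1 ∧ ∃ fstar : F → ZMod p, ∀ b : F,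
    walsh ζ f b = μ * (√(Fintype.card F : ℝ) : ℂ) * ζ ^ (fstar b).val

/-- Condition A for `f : 𝔽_{p^{2k}} → 𝔽_p`, with the sign `ε = (-1) ^ ((p - 1) k / 2) μ`, `μ = ±1`,
recorded as a parameter (as `μ` runs over `±1`, so does `ε`). -/
structure ConditionA {p : ℕ} [Fact p.Prime] {F : Type*} [Field F] [Fintype F] [Algebra (ZMod p) F]
    (k : ℕ) (ζ : ℂ) (f : F → ZMod p) (ε : ℤ) : Prop where
  weaklyRegularBent : IsWeaklyRegularBent ζ f
  map_zero : f 0 = 0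
  map_neg : ∀ x : F, f (-x) = f x
  homogeneous : ∃ l : ℤ, Int.gcd (l - 1) ((p : ℤ) - 1) = 1 ∧
    ∀ (α : ZMod p) (x : F), f (α • x) = α ^ l * f x
  sign : ε = 1 ∨ ε = -1
  walsh_eq : ∃ fstar : F → ZMod p, ∀ b : F,
    walsh ζ f b = (ε : ℂ) * (p : ℂ) ^ k * ζ ^ (fstar b).val

/-- `D = {x ≠ 0 | f x = 0}`. -/
def setD {p : ℕ} {F : Type*} [Field F] (f : F → ZMod p) : Set F :=
  {x | x ≠ 0 ∧ f x = 0}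

/-- `D_S = {x ≠ 0 | f x is a non-zero square}`. -/
def setDS {p : ℕ} {F : Type*} [Field F] (f : F → ZMod p) : Set F :=
  {x | x ≠ 0 ∧ f x ≠ 0 ∧ IsSquare (f x)}

/-- `D_N = {x ≠ 0 | f x is a non-square}`. -/
def setDN {p : ℕ} {F : Type*} [Field F] (f : F → ZMod p) : Set F :=
  {x | x ≠ 0 ∧ ¬ IsSquare (f x)}

/-- `(V; R 0, …, R d)` is an association scheme of class `d` on the finite set `V`
(empty relations are not excluded here). -/
structure IsAssociationScheme {V : Type*} [Finite V] {d : ℕ}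
    (R : Fin (d + 1) → Set (V × V)) : Prop where
  diag : R 0 = {q | q.1 = q.2}
  cover : (⋃ i, R i) = Set.univ
  disjoint : ∀ i j, i ≠ j → R i ∩ R j = ∅
  transpose : ∀ i, ∃ i', {q : V × V | (q.2, q.1) ∈ R i} = R i'
  intersection_numbers : ∀ i j k, ∃ c : ℕ, ∀ x y : V, (x, y) ∈ R k →
    Set.ncard {z : V | (x, z) ∈ R i ∧ (z, y) ∈ R j} = c

/-- The fusion of the relations `R i` along `π`: relations with the same image are united. -/
def fusion {V : Type*} {d e : ℕ} (R : Fin (d + 1) → Set (V × V))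
    (π : Fin (d + 1) → Fin (e + 1)) : Fin (e + 1) → Set (V × V) :=
  fun j => ⋃ i ∈ {i | π i = j}, R i

/-- An association scheme is amorphic if each of its fusions is an association scheme. A fusion
is given by a partition of the set `{1, …, d}` of indices of the nontrivial relations, that is, by a
surjection of index sets under which only `0` is sent to `0`. -/
def IsAmorphicAssociationScheme {V : Type*} [Finite V] {d : ℕ}
    (R : Fin (d + 1) → Set (V × V)) : Prop :=
  IsAssociationScheme R ∧
    ∀ (e : ℕ) (π : Fin (d + 1) → Fin (e + 1)), Function.Surjective π →
      (∀ i, π i = 0 ↔ i = 0) → IsAssociationScheme (fusion R π)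

/-- The relations `{(x, y) | x - y ∈ B i}` on an additive group given by subsets `B i`. -/
def cayleyRelations {G : Type*} [AddGroup G] {d : ℕ} (B : Fin (d + 1) → Set G) :
    Fin (d + 1) → Set (G × G) :=
  fun i => {q | q.1 - q.2 ∈ B i}

end

/-!
Write `χ x = ζ ^ Tr x` for the canonical additive character of `F`, and let `T ⊆ 𝔽_p` be one of
`{0}`, the nonzero squares, the non-squares. The indicator function of `f ⁻¹ T` is
`p⁻¹ ∑ t, ∑ c ∈ T, ζ ^ (t (f x - c))`. Since `gcd (l - 1, p - 1) = 1`, every `t ≠ 0` is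
`u ^ (1 - l)` for exactly one `u`; since `l` is even, `T` is stable under `c ↦ u ^ l c`. With
`x = u y` the terms for `u` become conjugates, under `ζ ↦ ζ ^ u`, of the Walsh sum
`W_f(b) = m ζ ^ f* b`, where `m = ε p ^ k` is an integer. The sum over `u` is then again an
orthogonality sum, so that no Gauss sums are needed, and for `b ≠ 0`
`∑_{f x ∈ T} χ (b x) = m [f* b ∈ T] - m |T| / p` (`sum_preimage_mul_traceAddChar`).

So the transforms of the classes `D`, `D_S`, `D_N` are, away from `0`, constants plus `m` times the
indicator functions of the disjoint sets given by the classes of `f*`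
(`isDualLabelling_quadraticLabel`). Products of such functions are linear combinations of them and
of `1`; inverting the transform, convolutions of classes are constant on classes
(`IsDualLabelling.exists_conv_eq`), which gives the intersection numbers. The property is inherited
by unions of classes because the factor `m` is common to all of them (`IsDualLabelling.comp`), and
this is why the scheme is amorphic.

The transform at `b = 0` gives the cardinalities (`mul_card_preimage`), once `f* 0 = 0` is known.
The latter is a parity argument: `f` is even, so it has an odd number of zeros. In particular
`|D| = (p ^ k - ε) (p ^ (k - 1) + ε)`, which vanishes exactly for `k = 1` and `ε = -1`.
-/

/-! ### Association schemes from a dual labelling -/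

/-- The Fourier transform of a function on a finite ring determines the function. -/
lemma eq_zero_of_forall_sum_mul_addChar_eq_zero {F : Type*} [CommRing F] [Fintype F]
    {χ : AddChar F ℂ} (hχ : χ.IsPrimitive) (g : F → ℂ)
    (hg : ∀ b, ∑ x, g x * χ (b * x) = 0) (y : F) : g y = 0 := by
  classical
  have h : ∑ b, (∑ x, g x * χ (b * x)) * χ (b * -y) = g y * Fintype.card F := by
    simp_rw [Finset.sum_mul, mul_assoc, ← AddChar.map_add_eq_mul, ← mul_add]
    rw [Finset.sum_comm]
    simp_rw [← Finset.mul_sum, AddChar.sum_mulShift _ hχ, add_neg_eq_zero]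
    simp
  have hq : (Fintype.card F : ℂ) ≠ 0 := by
    have : Nonempty F := ⟨0⟩
    exact_mod_cast Fintype.card_ne_zero
  simpa [hg, hq] using h

/-- Convolution becomes multiplication under the Fourier transform. -/
lemma sum_conv_mul_addChar {F : Type*} [CommRing F] [Fintype F]
    (χ : AddChar F ℂ) (g h : F → ℂ) (b : F) :
    ∑ w, (∑ u, g (w - u) * h u) * χ (b * w) =
      (∑ x, g x * χ (b * x)) * ∑ x, h x * χ (b * x) := by
  rw [Finset.sum_mul_sum]
  simp_rw [Finset.sum_mul]
  rw [Finset.sum_comm]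
  conv_rhs => rw [Finset.sum_comm]
  refine Finset.sum_congr rfl fun u _ => ?_
  refine Fintype.sum_equiv (Equiv.subRight u) _ _ fun w => ?_
  have : b * w = b * (w - u) + b * u := by ring
  rw [this, AddChar.map_add_eq_mul, Equiv.subRight_apply]
  ring

open Classical in
/-- A labelling `lab : F → Fin (d + 1)` of a finite ring which admits a dual labelling with respect
to `χ`: away from `0`, the Fourier transform of the indicator function of each class of `lab` is a
constant plus `s` times the indicator function of the class of `dual` with the same label, where
`s` is the same for all labels. -/
structure IsDualLabelling {F : Type*} [CommRing F] [Fintype F] {d : ℕ} (χ : AddChar F ℂ) (s : ℂ)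
    (lab dual : F → Fin (d + 1)) : Prop where
  eq_zero_iff : ∀ x, lab x = 0 ↔ x = 0
  map_neg : ∀ x, lab (-x) = lab x
  spectrum : ∀ i, ∃ β : ℂ, ∀ b, b ≠ 0 →
    ∑ x, (if lab x = i then 1 else 0) * χ (b * x) = β + s * if dual b = i then 1 else 0

namespace IsDualLabelling

variable {F : Type*} [CommRing F] [Fintype F] {d : ℕ} {χ : AddChar F ℂ} {s : ℂ}
  {lab dual : F → Fin (d + 1)}

/-- Uniting classes with `π` preserves duality, since the transform is additive and `s` does not
depend on the label. -/
lemma comp (h : IsDualLabelling χ s lab dual) {e : ℕ} {π : Fin (d + 1) → Fin (e + 1)}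
    (hπ : ∀ i, π i = 0 ↔ i = 0) : IsDualLabelling χ s (π ∘ lab) (π ∘ dual) where
  eq_zero_iff x := by simp [hπ, h.eq_zero_iff]
  map_neg x := by simp [h.map_neg]
  spectrum j := by
    classical
    choose β hβ using h.spectrum
    have key (a : Fin (d + 1)) : (if π a = j then (1 : ℂ) else 0) =
        ∑ i, if π i = j then (if a = i then 1 else 0) else 0 := by
      rw [Finset.sum_eq_single a] <;> simp +contextual [eq_comm]
    refine ⟨∑ i, if π i = j then β i else 0, fun b hb => ?_⟩
    simp_rw [Function.comp_apply, key, Finset.sum_mul, Finset.mul_sum]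
    rw [Finset.sum_comm, ← Finset.sum_add_distrib]
    refine Finset.sum_congr rfl fun i _ => ?_
    by_cases hi : π i = j
    · simpa only [if_pos hi] using hβ i b hb
    · simp [hi]

open Classical in
/-- The convolution of the indicator functions of two classes lies in the span of these two
functions, the indicator function of `0` and the constants. -/
lemma exists_conv_eq (hχ : χ.IsPrimitive) (h : IsDualLabelling χ s lab dual)
    (i j : Fin (d + 1)) : ∃ a₁ a₂ a₃ a₄ : ℂ, ∀ w : F,
      ∑ u, (if lab (w - u) = i then (1 : ℂ) else 0) * (if lab u = j then 1 else 0) =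
        a₁ * (if lab w = i then 1 else 0) + a₂ * (if lab w = j then 1 else 0) +
          a₃ * (if w = 0 then 1 else 0) + a₄ := by
  obtain ⟨β₁, h₁⟩ := h.spectrum i
  obtain ⟨β₂, h₂⟩ := h.spectrum j
  set g₁ : F → ℂ := fun x => if lab x = i then 1 else 0 with hg₁
  set g₂ : F → ℂ := fun x => if lab x = j then 1 else 0 with hg₂
  set κ : ℂ := if i = j then s else 0 with hκ
  have hq : (Fintype.card F : ℂ) ≠ 0 := by
    have : Nonempty F := ⟨0⟩
    exact_mod_cast Fintype.card_ne_zero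
  set a₁ : ℂ := κ + β₂
  set a₃ : ℂ := -(κ * β₁) - β₁ * β₂
  -- `a₁`, `β₁` and `a₃` are read off at `b ≠ 0`; then `a₄` corrects the transform at `b = 0`.
  set a₄ : ℂ := ((∑ x, g₁ x) * (∑ x, g₂ x) - a₁ * (∑ x, g₁ x) - β₁ * (∑ x, g₂ x) - a₃) /
    Fintype.card F with ha₄
  refine ⟨a₁, β₁, a₃, a₄, fun w => sub_eq_zero.1 ?_⟩
  refine eq_zero_of_forall_sum_mul_addChar_eq_zero hχ (fun w =>
    ∑ u, g₁ (w - u) * g₂ u - (a₁ * g₁ w + β₁ * g₂ w + a₃ * (if w = 0 then 1 else 0) + a₄))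
    (fun b => ?_) w
  have hconst : ∑ x, χ (b * x) = if b = 0 then (Fintype.card F : ℂ) else 0 := by
    simpa [mul_comm] using AddChar.sum_mulShift b hχ
  have hdelta : ∑ x, (if x = 0 then (1 : ℂ) else 0) * χ (b * x) = 1 := by
    simp [ite_mul]
  simp only [sub_mul, add_mul, mul_assoc, Finset.sum_sub_distrib, Finset.sum_add_distrib,
    ← Finset.mul_sum, sum_conv_mul_addChar, hconst, hdelta]
  by_cases hb : b = 0
  · simp only [hb, zero_mul, AddChar.map_zero_eq_one, mul_one, if_true]
    rw [ha₄]
    field_simp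
    ring
  · rw [h₁ b hb, h₂ b hb, if_neg hb]
    have hmul : s * (if dual b = i then (1 : ℂ) else 0) * (s * if dual b = j then 1 else 0) =
        κ * (s * if dual b = i then 1 else 0) := by
      rw [hκ]
      by_cases hij : i = j
      · subst hij
        rw [if_pos rfl]
        split_ifs <;> simp
      · by_cases hi : dual b = i
        · simp [hi, hij]
        · simp [hi]
    linear_combination hmul

/-- The relations `lab (x - y) = i` form an association scheme. -/
theorem isAssociationScheme (hχ : χ.IsPrimitive) (h : IsDualLabelling χ s lab dual) :
    IsAssociationScheme (cayleyRelations fun i => {x | lab x = i}) where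
  diag := by
    ext ⟨x, y⟩
    simp [cayleyRelations, h.eq_zero_iff, sub_eq_zero]
  cover := by
    ext q
    simp [cayleyRelations]
  disjoint i j hij := by
    ext q
    simp only [cayleyRelations, Set.mem_inter_iff, Set.mem_ofPred_eq, Set.mem_empty_iff_false,
      iff_false, not_and]
    rintro rfl
    exact hij
  transpose i := ⟨i, by
    ext ⟨x, y⟩
    have := h.map_neg (x - y)
    rw [neg_sub] at this
    simp [cayleyRelations, this]⟩
  intersection_numbers i j m := by
    classical
    obtain ⟨a₁, a₂, a₃, a₄, hconv⟩ := h.exists_conv_eq hχ i j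
    have hcount (x y : F) : (Set.ncard {z : F | lab (x - z) = i ∧ lab (z - y) = j} : ℂ) =
        ∑ u, (if lab (x - y - u) = i then (1 : ℂ) else 0) * (if lab u = j then 1 else 0) := by
      rw [Set.ncard_eq_toFinset_card', Set.toFinset_ofPred, Finset.card_filter]
      push_cast
      refine Fintype.sum_equiv (Equiv.subRight y) _ _ fun z => ?_
      rw [Equiv.subRight_apply, sub_sub_sub_cancel_right, ite_and]
      split_ifs <;> simp
    by_cases hm : ∃ w, lab w = m
    · obtain ⟨w, hw⟩ := hm
      refine ⟨Set.ncard {z : F | lab (w - z) = i ∧ lab (z - 0) = j}, fun x y hxy => ?_⟩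
      have hxy : lab (x - y) = m := hxy
      have hzero : x - y = 0 ↔ w = 0 := by rw [← h.eq_zero_iff, ← h.eq_zero_iff, hxy, hw]
      refine Nat.cast_injective (R := ℂ) ?_
      refine (hcount x y).trans (Eq.trans ?_ (hcount w 0).symm)
      rw [hconv, hconv, sub_zero, hxy, hw]
      simp only [hzero]
    · exact ⟨0, fun x y hxy => (hm ⟨_, hxy⟩).elim⟩

/-- Each fusion comes from the labelling obtained by uniting labels, so the scheme is amorphic. -/
theorem isAmorphicAssociationScheme (hχ : χ.IsPrimitive) (h : IsDualLabelling χ s lab dual) :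
    IsAmorphicAssociationScheme (cayleyRelations fun i => {x | lab x = i}) := by
  refine ⟨h.isAssociationScheme hχ, fun e π _ hπ => ?_⟩
  convert (h.comp hπ).isAssociationScheme hχ using 1
  ext j q
  simp [fusion, cayleyRelations]

end IsDualLabelling

/-! ### The Walsh transform under rescaling -/

section Walsh

variable {p : ℕ} [Fact p.Prime] {ζ : ℂ}

/-- The Galois automorphism `ζ ↦ ζ ^ u` of `ℚ(ζ)`, applied to an evaluation of an exponential sum
over `𝔽_p` of the form `m ζ ^ c` with an integer `m`. -/
lemma sum_zmodChar_unit_mul (hζ : IsPrimitiveRoot ζ p) {ι : Type*} [Fintype ι]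
    (g : ι → ZMod p) (m : ℤ) (c : ZMod p)
    (h : ∑ y, AddChar.zmodChar p hζ.pow_eq_one (g y) =
      m * AddChar.zmodChar p hζ.pow_eq_one c) (u : (ZMod p)ˣ) :
    ∑ y, AddChar.zmodChar p hζ.pow_eq_one (u * g y) =
      m * AddChar.zmodChar p hζ.pow_eq_one (u * c) := by
  have hpow (a : ZMod p) : AddChar.zmodChar p hζ.pow_eq_one (u * a) =
      (ζ ^ (u : ZMod p).val) ^ a.val := by
    rw [← pow_mul, ← AddChar.zmodChar_apply' hζ.pow_eq_one]
    simp
  simp_rw [hpow]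
  simp_rw [AddChar.zmodChar_apply] at h
  let P : Polynomial ℤ := ∑ y, Polynomial.X ^ (g y).val - Polynomial.C m * Polynomial.X ^ c.val
  have haeval (z : ℂ) : Polynomial.aeval z P = ∑ y, z ^ (g y).val - m * z ^ c.val := by
    simp [P]
  have hP : Polynomial.aeval ζ P = 0 := by rw [haeval, h, sub_self]
  have hdvd := minpoly.isIntegrallyClosed_dvd (hζ.isIntegral (Fact.out : p.Prime).pos) hP
  rw [hζ.minpoly_eq_pow_coprime (ZMod.val_coe_unit_coprime u)] at hdvd
  have := Polynomial.aeval_eq_zero_of_dvd_aeval_eq_zero hdvd (minpoly.aeval ℤ _)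
  rwa [haeval, sub_eq_zero] at this

/-- Summation over the nonzero elements, for a nontrivial additive character of `𝔽_p`. -/
lemma sum_units_addChar_mul {ψ : AddChar (ZMod p) ℂ} (hψ : ψ.IsPrimitive) (a : ZMod p) :
    ∑ u : (ZMod p)ˣ, ψ (u * a) = (p : ℂ) * (if a = 0 then 1 else 0) - 1 := by
  have h := AddChar.sum_mulShift a hψ
  rw [Fintype.sum_eq_add_sum_compl (0 : ZMod p) (fun x => ψ (x * a)),
    Finset.sum_subtype (F := inferInstance) (p := fun x : ZMod p => x ≠ 0) _ (by simp),
    ← Fintype.sum_equiv unitsEquivNeZero (fun u : (ZMod p)ˣ => ψ (u * a)) _ (fun u => rfl)] at h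
  rw [zero_mul, AddChar.map_zero_eq_one, ZMod.card] at h
  rw [eq_sub_iff_add_eq', h]
  split_ifs <;> simp

/-- If `n` is coprime to `p - 1`, then `u ↦ u ^ n` permutes `𝔽_pˣ`. -/
lemma zpow_bijective_units_zmod {n : ℤ} (hn : Int.gcd n ((p : ℤ) - 1) = 1) :
    Function.Bijective fun u : (ZMod p)ˣ => u ^ n := by
  refine Function.Injective.bijective_of_finite ((injective_iff_map_eq_one
    (zpowGroupHom n : (ZMod p)ˣ →* (ZMod p)ˣ)).2 fun u hu => ?_)
  have h₁ : (orderOf u : ℤ) ∣ n := orderOf_dvd_iff_zpow_eq_one.2 hu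
  have h₂ : (orderOf u : ℤ) ∣ (p : ℤ) - 1 := by
    have := (Fact.out : p.Prime).one_le
    have h := orderOf_dvd_card (x := u)
    rw [ZMod.card_units] at h
    have : ((p - 1 : ℕ) : ℤ) = (p : ℤ) - 1 := by push_cast [this]; ring
    rw [← this]
    exact_mod_cast h
  have h₃ := Int.dvd_coe_gcd h₁ h₂
  rw [hn] at h₃
  exact orderOf_eq_one_iff.1 (by exact_mod_cast Int.eq_one_of_dvd_one (by positivity) h₃)

end Walsh

/-! ### Fourier transforms of preimages under a homogeneous bent function -/

section Preimage

variable {p : ℕ} [Fact p.Prime] {F : Type*} [Field F] [Algebra (ZMod p) F]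

open Classical in
/-- Orthogonality over `𝔽_p`, written with `f` evaluated at rescaled arguments. In the double sum,
homogeneity and the invariance of `T` replace the factor `u` by `u ^ (1 - l)`, which again runs
through all nonzero elements. -/
lemma sum_units_homogeneous {ψ : AddChar (ZMod p) ℂ} (hψ : ψ.IsPrimitive) {f : F → ZMod p} {l : ℤ}
    (hl : Int.gcd (l - 1) ((p : ℤ) - 1) = 1) (heven : Even l)
    (hhom : ∀ (α : ZMod p) (x : F), f (α • x) = α ^ l * f x) {T : Finset (ZMod p)}
    (hT : ∀ (u : (ZMod p)ˣ) (a : ZMod p), (u : ZMod p) ^ 2 * a ∈ T ↔ a ∈ T) (x : F) :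
    ∑ u : (ZMod p)ˣ, ∑ c ∈ T, ψ (u * (f ((u : ZMod p)⁻¹ • x) - c)) =
      p * (if f x ∈ T then 1 else 0) - T.card := by
  have hTl (u : (ZMod p)ˣ) (a : ZMod p) : (u : ZMod p) ^ l * a ∈ T ↔ a ∈ T := by
    obtain ⟨r, rfl⟩ := heven
    have := hT (u ^ r) a
    rwa [Units.val_zpow_eq_zpow_val, sq, ← zpow_add₀ u.ne_zero] at this
  have hscale (u : (ZMod p)ˣ) : ∑ c ∈ T, ψ (u * (f ((u : ZMod p)⁻¹ • x) - c)) =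
      ∑ c ∈ T, ψ (((u ^ (1 - l) : (ZMod p)ˣ) : ZMod p) * (f x - c)) := by
    have hu := u.ne_zero
    have hul : (u : ZMod p) ^ l ≠ 0 := zpow_ne_zero _ hu
    refine Finset.sum_bij' (fun c _ => (u : ZMod p) ^ l * c)
      (fun c _ => ((u : ZMod p) ^ l)⁻¹ * c) (fun c hc => (hTl u c).2 hc)
      (fun c hc => (hTl u _).1 (by rwa [mul_inv_cancel_left₀ hul]))
      (fun c _ => by simp [hul]) (fun c _ => by simp [hul]) (fun c _ => ?_)
    congr 1
    rw [hhom, Units.val_zpow_eq_zpow_val, zpow_sub₀ hu, zpow_one, inv_zpow]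
    field_simp
  have hl' : Int.gcd (1 - l) ((p : ℤ) - 1) = 1 := by rw [← neg_sub, Int.neg_gcd, hl]
  simp_rw [hscale]
  rw [(zpow_bijective_units_zmod hl').sum_comp
    (fun v : (ZMod p)ˣ => ∑ c ∈ T, ψ (v * (f x - c))), Finset.sum_comm]
  simp_rw [sum_units_addChar_mul hψ, sub_eq_zero]
  rw [Finset.sum_sub_distrib, ← Finset.mul_sum]
  simp

variable [Fintype F]

/-- The additive character `x ↦ ψ (Tr x)` of `F`, for an additive character `ψ` of `𝔽_p`. -/
noncomputable def traceAddChar (F : Type*) [Field F] [Fintype F] [Algebra (ZMod p) F]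
    (ψ : AddChar (ZMod p) ℂ) : AddChar F ℂ :=
  ψ.compAddMonoidHom (Algebra.trace (ZMod p) F).toAddMonoidHom

lemma traceAddChar_apply (ψ : AddChar (ZMod p) ℂ) (x : F) :
    traceAddChar F ψ x = ψ (Algebra.trace (ZMod p) F x) := rfl

lemma traceAddChar_isPrimitive {ψ : AddChar (ZMod p) ℂ} (hψ : ψ.IsPrimitive) :
    (traceAddChar F ψ).IsPrimitive := by
  refine AddChar.IsPrimitive.of_ne_one fun h => ?_
  have hψ₁ : ψ ≠ 1 := by simpa using hψ one_ne_zero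
  obtain ⟨a, ha⟩ := AddChar.ne_one_iff.1 hψ₁
  obtain ⟨x, rfl⟩ := Algebra.trace_surjective (ZMod p) F a
  exact ha (by rw [← traceAddChar_apply, h, AddChar.one_apply])

open Classical in
/-- The Fourier transform of the indicator function of `f ⁻¹ T`, for a set `T` closed under
multiplication by nonzero squares. -/
lemma sum_preimage_mul_traceAddChar {ζ : ℂ} (hζ : IsPrimitiveRoot ζ p) {f : F → ZMod p} {l : ℤ}
    (hl : Int.gcd (l - 1) ((p : ℤ) - 1) = 1) (heven : Even l)
    (hhom : ∀ (α : ZMod p) (x : F), f (α • x) = α ^ l * f x) {m : ℤ} {fstar : F → ZMod p}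
    (hW : ∀ b, walsh ζ f b = m * ζ ^ (fstar b).val) {T : Finset (ZMod p)}
    (hT : ∀ (u : (ZMod p)ˣ) (a : ZMod p), (u : ZMod p) ^ 2 * a ∈ T ↔ a ∈ T) (b : F) :
    (p : ℂ) * ∑ x, (if f x ∈ T then 1 else 0) *
        traceAddChar F (AddChar.zmodChar p hζ.pow_eq_one) (b * x) =
      T.card * ∑ x, traceAddChar F (AddChar.zmodChar p hζ.pow_eq_one) (b * x) +
        m * (p * (if fstar b ∈ T then 1 else 0) - T.card) := by
  set ψ := AddChar.zmodChar p hζ.pow_eq_one with hψdef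
  have hψ : ψ.IsPrimitive := AddChar.zmodChar_primitive_of_primitive_root p hζ
  have hW' : ∑ y, ψ (f y + Algebra.trace (ZMod p) F (b * y)) = m * ψ (fstar b) := by
    simpa only [hψdef, AddChar.zmodChar_apply] using! hW b
  have hpt (x : F) : (p : ℂ) * (if f x ∈ T then 1 else 0) = T.card +
      ∑ u : (ZMod p)ˣ, ∑ c ∈ T, ψ (u * (f ((u : ZMod p)⁻¹ • x) - c)) := by
    rw [sum_units_homogeneous hψ hl heven hhom hT]; ring
  -- After the substitution `x = u y` the inner sums are conjugates of the Walsh sum at `b`.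
  have hsub (u : (ZMod p)ˣ) (c : ZMod p) :
      ∑ x, ψ (u * (f ((u : ZMod p)⁻¹ • x) - c)) * traceAddChar F ψ (b * x) =
        m * ψ (u * (fstar b - c)) := by
    rw [mul_sub, sub_eq_add_neg, AddChar.map_add_eq_mul, ← mul_assoc,
      ← sum_zmodChar_unit_mul hζ _ m _ hW' u, Finset.sum_mul]
    refine (Fintype.sum_equiv (MulAction.toPerm u) _ _ fun y => ?_).symm
    rw [MulAction.toPerm_apply, Units.smul_def, inv_smul_smul₀ u.ne_zero, traceAddChar_apply,
      mul_smul_comm, map_smul, smul_eq_mul, ← AddChar.map_add_eq_mul, ← AddChar.map_add_eq_mul]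
    congr 1
    ring
  rw [Finset.mul_sum]
  simp_rw [← mul_assoc, hpt, add_mul, Finset.sum_add_distrib, Finset.sum_mul]
  rw [← Finset.mul_sum, Finset.sum_comm]
  congr 1
  have hcomm (u : (ZMod p)ˣ) :
      ∑ x, ∑ c ∈ T, ψ (u * (f ((u : ZMod p)⁻¹ • x) - c)) * traceAddChar F ψ (b * x) =
        ∑ c ∈ T, m * ψ (u * (fstar b - c)) := by
    rw [Finset.sum_comm]
    exact Finset.sum_congr rfl fun c _ => hsub u c
  simp_rw [hcomm, ← Finset.mul_sum]
  rw [Finset.sum_comm]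
  simp_rw [sum_units_addChar_mul hψ, sub_eq_zero]
  rw [Finset.sum_sub_distrib, ← Finset.mul_sum]
  simp

end Preimage

/-! ### Quadratic classes and cardinalities -/

section QuadraticClass

variable {p : ℕ} [Fact p.Prime] {F : Type*} [Field F]

open Classical in
/-- The orbit of an element of `𝔽_p` under nonzero squares: `1` for zero, `2` for the nonzero
squares and `3` for the non-squares. The label `0` is left for the zero element of `F`. -/
noncomputable def quadraticClass (a : ZMod p) : Fin 4 :=
  if a = 0 then 1 else if IsSquare a then 2 else 3

lemma quadraticClass_ne_zero (a : ZMod p) : quadraticClass a ≠ 0 := by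
  unfold quadraticClass
  split_ifs <;> decide

lemma quadraticClass_sq_mul (u : (ZMod p)ˣ) (a : ZMod p) :
    quadraticClass ((u : ZMod p) ^ 2 * a) = quadraticClass a := by
  have h : IsSquare ((u : ZMod p) ^ 2 * a) ↔ IsSquare a := by
    refine ⟨fun h => ?_, fun h => (IsSquare.sq _).mul h⟩
    have := (IsSquare.sq ((u⁻¹ : (ZMod p)ˣ) : ZMod p)).mul h
    rwa [← mul_assoc, ← mul_pow, Units.inv_mul, one_pow, one_mul] at this
  simp [quadraticClass, h]

open Classical in
/-- The label of `x`: `0` for `x = 0`, otherwise the class of `f x`. -/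
noncomputable def quadraticLabel (f : F → ZMod p) (x : F) : Fin 4 :=
  if x = 0 then 0 else quadraticClass (f x)

lemma cayleyRelations_quadraticLabel (f : F → ZMod p) :
    cayleyRelations (d := 3) ![{(0 : F)}, setD f, setDS f, setDN f] =
      cayleyRelations fun i => {x | quadraticLabel f x = i} := by
  congr 1
  funext i
  have h0 (x : F) : quadraticLabel f x = 0 ↔ x = 0 := by
    by_cases hx : x = 0 <;> simp [quadraticLabel, hx, quadraticClass_ne_zero]
  have h1 (x : F) : quadraticLabel f x = 1 ↔ x ≠ 0 ∧ f x = 0 := by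
    unfold quadraticLabel quadraticClass
    split_ifs with hx h <;> simp [*]
  have h2 (x : F) : quadraticLabel f x = 2 ↔ x ≠ 0 ∧ f x ≠ 0 ∧ IsSquare (f x) := by
    unfold quadraticLabel quadraticClass
    split_ifs with hx h <;> simp [*]
  have h3 (x : F) : quadraticLabel f x = 3 ↔ x ≠ 0 ∧ ¬ IsSquare (f x) := by
    unfold quadraticLabel quadraticClass
    split_ifs with hx h <;> simp [*]
  fin_cases i
  · exact Set.ext fun x => (h0 x).symm
  · exact Set.ext fun x => (h1 x).symm
  · exact Set.ext fun x => (h2 x).symm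
  · exact Set.ext fun x => (h3 x).symm

variable [Fintype F] [Algebra (ZMod p) F]

/-- The classes of a homogeneous weakly regular bent function have the classes of `f*` as duals. -/
lemma isDualLabelling_quadraticLabel {ζ : ℂ} (hζ : IsPrimitiveRoot ζ p) {f : F → ZMod p} {l : ℤ}
    (hl : Int.gcd (l - 1) ((p : ℤ) - 1) = 1) (heven : Even l)
    (hhom : ∀ (α : ZMod p) (x : F), f (α • x) = α ^ l * f x) (hf0 : f 0 = 0)
    (hneg : ∀ x, f (-x) = f x) {m : ℤ} {fstar : F → ZMod p}
    (hW : ∀ b, walsh ζ f b = m * ζ ^ (fstar b).val) :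
    IsDualLabelling (traceAddChar F (AddChar.zmodChar p hζ.pow_eq_one)) (m : ℂ)
      (quadraticLabel f) (quadraticClass ∘ fstar) where
  eq_zero_iff x := by
    by_cases hx : x = 0 <;> simp [quadraticLabel, hx, quadraticClass_ne_zero]
  map_neg x := by by_cases hx : x = 0 <;> simp [quadraticLabel, hneg, hx]
  spectrum i := by
    classical
    set χ := traceAddChar F (AddChar.zmodChar p hζ.pow_eq_one)
    have hχ : χ.IsPrimitive :=
      traceAddChar_isPrimitive (AddChar.zmodChar_primitive_of_primitive_root p hζ)
    set T : Finset (ZMod p) := Finset.univ.filter fun a => quadraticClass a = i with hTdef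
    have hT (u : (ZMod p)ˣ) (a : ZMod p) : (u : ZMod p) ^ 2 * a ∈ T ↔ a ∈ T := by
      simp [hTdef, quadraticClass_sq_mul]
    -- The correction `κ` moves `0 : F` from the class of `f 0 = 0` to the class labelled `0`.
    set κ : ℂ := (if (0 : Fin 4) = i then 1 else 0) - if (1 : Fin 4) = i then 1 else 0 with hκ
    refine ⟨κ - m * T.card / p, fun b hb => ?_⟩
    have hp : (p : ℂ) ≠ 0 := by exact_mod_cast (Fact.out : p.Prime).ne_zero
    have hpre := sum_preimage_mul_traceAddChar hζ hl heven hhom hW hT b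
    have hsum : ∑ x, χ (b * x) = 0 := by
      simpa [mul_comm, hb] using AddChar.sum_mulShift b hχ
    have hlab (x : F) : (if quadraticLabel f x = i then (1 : ℂ) else 0) * χ (b * x) =
        (if f x ∈ T then 1 else 0) * χ (b * x) + if x = 0 then κ else 0 := by
      by_cases hx : x = 0
      · have h1 : quadraticClass (0 : ZMod p) = 1 := by simp [quadraticClass]
        simp [hx, hf0, quadraticLabel, hTdef, hκ, h1]
      · simp [hx, quadraticLabel, hTdef]
    simp_rw [hlab]
    rw [Finset.sum_add_distrib, Finset.sum_ite_eq']
    change (p : ℂ) * ∑ x, _ * χ (b * x) = _ * ∑ x, χ (b * x) + _ at hpre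
    rw [hsum] at hpre
    have hmem : fstar b ∈ T ↔ (quadraticClass ∘ fstar) b = i := by simp [hTdef]
    simp only [hmem] at hpre
    simp only [Finset.mem_univ, if_true]
    field_simp
    linear_combination hpre

open Classical in
/-- The cardinality of the preimage of a set closed under multiplication by nonzero squares. -/
lemma mul_card_preimage {ζ : ℂ} (hζ : IsPrimitiveRoot ζ p) {f : F → ZMod p} {l : ℤ}
    (hl : Int.gcd (l - 1) ((p : ℤ) - 1) = 1) (heven : Even l)
    (hhom : ∀ (α : ZMod p) (x : F), f (α • x) = α ^ l * f x) {m : ℤ} {fstar : F → ZMod p}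
    (hW : ∀ b, walsh ζ f b = m * ζ ^ (fstar b).val) {T : Finset (ZMod p)}
    (hT : ∀ (u : (ZMod p)ˣ) (a : ZMod p), (u : ZMod p) ^ 2 * a ∈ T ↔ a ∈ T) :
    (p : ℤ) * (Finset.univ.filter fun x => f x ∈ T).card =
      T.card * Fintype.card F + m * (p * (if fstar 0 ∈ T then 1 else 0) - T.card) := by
  have h := sum_preimage_mul_traceAddChar hζ hl heven hhom hW hT 0
  simp only [zero_mul, AddChar.map_zero_eq_one, mul_one, Finset.sum_boole, Finset.sum_const,
    Finset.card_univ, nsmul_eq_mul] at h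
  exact_mod_cast h

end QuadraticClass

/-- An even function vanishing at `0` has an odd number of zeros. -/
lemma odd_card_zeros {F M : Type*} [Field F] [Fintype F] [DecidableEq F] [Zero M] [DecidableEq M]
    (h2 : (2 : F) ≠ 0) {f : F → M} (hf0 : f 0 = 0)
    (hneg : ∀ x, f (-x) = f x) : Odd (Finset.univ.filter fun x => f x = 0).card := by
  set s := Finset.univ.filter fun x => f x = 0
  have h0 : (0 : F) ∈ s := by simp [s, hf0]
  have heven : Even (s.erase 0).card := by
    rw [← ZMod.natCast_eq_zero_iff_even, Finset.card_eq_sum_ones, Nat.cast_sum]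
    refine Finset.sum_involution (fun x _ => -x) (fun _ _ => by decide) (fun x hx _ h => ?_)
      (fun x hx => ?_) (fun x _ => neg_neg x)
    · have : 2 * x = 0 := by rw [two_mul]; nth_rewrite 1 [← h]; exact neg_add_cancel x
      exact (Finset.mem_erase.1 hx).1 ((mul_eq_zero.1 this).resolve_left h2)
    · simpa [s, hneg] using hx
  rw [← Finset.card_erase_add_one h0]
  exact heven.add_one

/-! ### The amorphic scheme -/

theorem theorem4 {p : ℕ} [Fact p.Prime] (hp : p ≠ 2) {k : ℕ}
    {F : Type*} [Field F] [Fintype F] [Algebra (ZMod p) F] (hF : Fintype.card F = p ^ (2 * k))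
    {ζ : ℂ} (hζ : IsPrimitiveRoot ζ p) {f : F → ZMod p} {ε : ℤ} (hf : ConditionA k ζ f ε) :
    IsAmorphicAssociationScheme
        (cayleyRelations (d := 3) ![{(0 : F)}, setD f, setDS f, setDN f]) ∧
      (setDS f).Nonempty ∧ (setDN f).Nonempty ∧
      ((setD f).Nonempty ↔ ¬ (k = 1 ∧ ε = -1)) := by
  classical
  obtain ⟨-, hf0, hneg, ⟨l, hl, hhom⟩, hε, fstar, hW⟩ := hf
  have hprime : p.Prime := Fact.out
  have hodd : Odd p := hprime.odd_of_ne_two hp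
  have hp3 : 3 ≤ p := by have := hprime.two_le; omega
  have hW' (b : F) : walsh ζ f b = ((ε * p ^ k : ℤ) : ℂ) * ζ ^ (fstar b).val := by
    rw [hW]; push_cast; rfl
  -- `p - 1` is even, so `l - 1` is odd.
  have heven : Even l := by
    by_contra hlodd
    have h₁ : (2 : ℤ) ∣ l - 1 := ((Int.not_even_iff_odd.1 hlodd).sub_odd odd_one).two_dvd
    have h₂ : (2 : ℤ) ∣ (p : ℤ) - 1 := (((Int.odd_coe_nat p).2 hodd).sub_odd odd_one).two_dvd
    have h₃ := Int.dvd_coe_gcd h₁ h₂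
    rw [hl] at h₃
    norm_num at h₃
  obtain ⟨j, rfl⟩ : ∃ j, k = j + 1 := by
    refine Nat.exists_eq_succ_of_ne_zero ?_
    rintro rfl
    have := Fintype.one_lt_card (α := F)
    simp [hF] at this
  set P : ℤ := (p : ℤ) ^ j with hP
  have hP1 : 1 ≤ P := one_le_pow₀ (by omega)
  have hpZ : (3 : ℤ) ≤ p := by exact_mod_cast hp3
  have hpP : (p : ℤ) ^ (j + 1) = p * P := by rw [pow_succ, mul_comm]
  have hcard : (Fintype.card F : ℤ) = (p * P) ^ 2 := by
    rw [hF, ← hpP, ← pow_mul]; push_cast; ring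
  have hcount (T : Finset (ZMod p))
      (hT : ∀ (u : (ZMod p)ˣ) (a : ZMod p), (u : ZMod p) ^ 2 * a ∈ T ↔ a ∈ T) :
      ((Finset.univ.filter fun x => f x ∈ T).card : ℤ) =
        T.card * (p * P ^ 2) + ε * P * (p * (if fstar 0 ∈ T then 1 else 0) - T.card) := by
    have h := mul_card_preimage hζ hl heven hhom hW' hT
    rw [hcard, hpP] at h
    refine mul_left_cancel₀ (show (p : ℤ) ≠ 0 by omega) (h.trans ?_)
    ring
  have hzeros : ((Finset.univ.filter fun x => f x = 0).card : ℤ) =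
      p * P ^ 2 + ε * P * (p * (if fstar 0 = 0 then 1 else 0) - 1) := by
    simpa using hcount {0} (fun u a => by simp)
  have hpodd : Odd (p : ℤ) := (Int.odd_coe_nat p).2 hodd
  have hPodd : Odd P := hpodd.pow
  have hεodd : Odd ε := by rcases hε with rfl | rfl <;> decide
  -- The number of zeros of `f` is odd, since `f` is even; `f* 0 ≠ 0` would make it even.
  have hfstar : fstar 0 = 0 := by
    by_contra hne
    have h2 : (2 : F) ≠ 0 := by
      have : CharP F p := charP_of_injective_algebraMap (algebraMap (ZMod p) F).injective p
      intro h
      have := (CharP.cast_eq_zero_iff F p 2).1 (by exact_mod_cast h)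
      exact hp ((Nat.prime_dvd_prime_iff_eq hprime Nat.prime_two).1 this)
    have h := (Int.odd_coe_nat _).2 (odd_card_zeros h2 hf0 hneg)
    rw [hzeros, if_neg hne] at h
    refine Int.not_even_iff_odd.2 h ((hpodd.mul hPodd.pow).add_odd ?_)
    simpa using (hεodd.mul hPodd).neg
  have hfac : 0 < P * (p * P - ε) := by
    refine mul_pos (by omega) ?_
    rcases hε with rfl | rfl <;> nlinarith
  have hex {i : Fin 4} (hi : i ≠ 1) {a : ZMod p} (ha : quadraticClass a = i) :
      ∃ x, quadraticClass (f x) = i := by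
    have h := hcount (Finset.univ.filter fun a => quadraticClass a = i)
      (fun u a => by simp [quadraticClass_sq_mul])
    have h0 : quadraticClass (fstar 0) ≠ i := by
      simpa [hfstar, quadraticClass] using hi.symm
    have hT : 0 < (Finset.univ.filter fun a : ZMod p => quadraticClass a = i).card :=
      Finset.card_pos.2 ⟨a, by simp [ha]⟩
    simp only [Finset.mem_filter, Finset.mem_univ, true_and, if_neg h0] at h
    have hpos : 0 < (Finset.univ.filter fun x => quadraticClass (f x) = i).card := by
      zify at hT ⊢
      rw [h]
      nlinarith [mul_pos hT hfac]
    obtain ⟨x, hx⟩ := Finset.card_pos.1 hpos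
    exact ⟨x, by simpa using hx⟩
  refine ⟨?_, ?_, ?_, ?_⟩
  · rw [cayleyRelations_quadraticLabel]
    exact (isDualLabelling_quadraticLabel hζ hl heven hhom hf0 hneg hW').isAmorphicAssociationScheme
      (traceAddChar_isPrimitive (AddChar.zmodChar_primitive_of_primitive_root p hζ))
  · obtain ⟨x, hx⟩ := hex (i := 2) (a := 1) (by decide) (by simp [quadraticClass])
    have h0 : f x ≠ 0 := by rintro h; simp [quadraticClass, h] at hx
    refine ⟨x, ?_, h0, ?_⟩
    · rintro rfl; exact h0 hf0
    · by_contra h; simp [quadraticClass, h0, h] at hx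
  · obtain ⟨a, ha⟩ := FiniteField.exists_nonsquare (F := ZMod p) (by rwa [ZMod.ringChar_zmod_n])
    obtain ⟨x, hx⟩ := hex (i := 3) (a := a) (by decide) (by
      have : a ≠ 0 := by rintro rfl; exact ha IsSquare.zero
      simp [quadraticClass, ha, this])
    have h : ¬ IsSquare (f x) := by
      intro h; by_cases h0 : f x = 0 <;> simp [quadraticClass, h0, h] at hx
    refine ⟨x, ?_, h⟩
    rintro rfl; exact h (hf0 ▸ IsSquare.zero)
  · rw [hfstar, if_pos rfl, mul_one] at hzeros
    have hD : (setD f).Nonempty ↔ (Finset.univ.filter fun x => f x = 0).card ≠ 1 := by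
      have h0 : (0 : F) ∈ Finset.univ.filter fun x => f x = 0 := by simp [hf0]
      refine ⟨fun ⟨x, hx, hfx⟩ h => hx ?_, fun h => ?_⟩
      · exact Finset.card_le_one.1 h.le x (by simp [hfx]) 0 h0
      · have hpos := Finset.card_pos.2 ⟨0, h0⟩
        obtain ⟨x, hx, hne⟩ := Finset.exists_mem_ne
          (show 1 < (Finset.univ.filter fun x => f x = 0).card by omega) (0 : F)
        exact ⟨x, hne, by simpa using hx⟩
    -- `|D| = (p ^ k - ε) (p ^ (k - 1) + ε)`
    have hfactor : ((Finset.univ.filter fun x => f x = 0).card : ℤ) - 1 =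
        (p * P - ε) * (P + ε) := by
      have : ε ^ 2 = 1 := by rcases hε with rfl | rfl <;> rfl
      rw [hzeros]
      linear_combination this
    rw [hD, not_iff_not, ← Nat.cast_inj (R := ℤ), Nat.cast_one, ← sub_eq_zero, hfactor, mul_eq_zero,
      or_iff_right (pos_of_mul_pos_right hfac (by omega)).ne']
    have hj : j + 1 = 1 ↔ P = 1 := by
      rw [hP, pow_eq_one_iff_cases]
      omega
    rw [hj]
    rcases hε with rfl | rfl <;> omega
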